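/- Let $\mathcal{RP}$ denote the proper real rational transfer matrices and $\mathcal{RH}_\infty$ those with all poles in the open left half plane. Let the subsystem of interest $$\begin{bmatrix} w\\ y\end{bmatrix}=G\begin{bmatrix} v\\ u\end{bmatrix},\qquad G=\begin{bmatrix} G_{wv} & G_{wu}\\ G_{yv} & G_{yu}\end{bmatrix},$$ be a strictly proper real rational transfer matrix, possibly unstable. For an environment $v=\overline G w$ and a controller $u=Ky$ with $\overline G, K\in\mathcal{RP}$, consider the loop equations $u=Ky+\delta_u$, $y=G_{yv}v+G_{yu}u+\delta_y$, $v=\overline G w+\delta_v$, $w=G_{wv}v+G_{wu}u+\delta_w$. The control system is internally stable if these equations are uniquely solvable and the sixteen transfer matrices from $(\delta_u,\delta_y,\delta_v,\delta_w)$ to $(u,y,v,w)$ all belong to $\mathcal{RH}_\infty$. The environment $\overline G\in\mathcal{RP}$ is admissible if the system without the controller (that is, with $K=0$) is internally stable, and $K\in\mathcal{RP}$ is a retrofit controller if the control system is internally stable for every admissible environment. Assume that at least one admissible environment exists. Let $N_r,M_r,U_r,V_r,N_l,M_l,U_l,V_l\in\mathcal{RH}_\infty$ be a doubly coprime factorization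 of $G_{wv}$, that is, $M_r$ and $M_l$ are invertible, $G_{wv}=N_rM_r^{-1}=M_l^{-1}N_l$ and $$\begin{bmatrix} V_l & -U_l\\ -N_l & M_l\end{bmatrix}\begin{bmatrix} M_r & U_r\\ N_r & V_r\end{bmatrix}=I.$$ Put $\tilde G_{yu}=G_{yu}+G_{yv}U_rM_lG_{wu}$, and for $K\in\mathcal{RP}$ put $\tilde Q=(I-K\tilde G_{yu})^{-1}K$. Then $K$ is a retrofit controller if and only if $$\tilde Q\in\mathcal{RH}_\infty\quad\text{and}\quad G_{wu}\tilde Q G_{yv}=0.$$ -/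

import Mathlib

open Matrix

namespace Retrofit

/-- A real rational function is proper if the degree of its numerator (in lowest terms) is at most
that of its denominator. -/
def IsProper (r : RatFunc ℝ) : Prop :=
  r.num.degree ≤ r.denom.degree

/-- A real rational function is strictly proper if the degree of its numerator is smaller than that
of its denominator. -/
def IsStrictlyProper (r : RatFunc ℝ) : Prop :=
  r.num.degree < r.denom.degree

/-- All poles (complex zeros of the denominator in lowest terms) lie in the open left half plane. -/
def HasStablePoles (r : RatFunc ℝ) : Prop :=
  ∀ s : ℂ, Polynomial.aeval s r.denom = 0 → s.re < 0

/-- An `m × n` real rational transfer matrix. -/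
abbrev TransferMatrix (m n : Type*) := Matrix m n (RatFunc ℝ)

/-- Membership in `RP`: real rational and proper. -/
def IsRP {m n : Type*} (A : TransferMatrix m n) : Prop :=
  ∀ i j, IsProper (A i j)

/-- Strictly proper transfer matrices, i.e. those of the form `C (sI - A)⁻¹ B`. -/
def IsStrictRP {m n : Type*} (A : TransferMatrix m n) : Prop :=
  ∀ i j, IsStrictlyProper (A i j)

/-- Membership in `RH∞`: real rational, proper and stable. -/
def IsRHInf {m n : Type*} (A : TransferMatrix m n) : Prop :=
  ∀ i j, IsProper (A i j) ∧ HasStablePoles (A i j)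

/-- The eight matrices form a doubly coprime factorization of `G` over `RH∞`. -/
structure IsDoublyCoprime {w v : Type*} [Fintype w] [Fintype v] [DecidableEq w] [DecidableEq v]
    (G : TransferMatrix w v)
    (Nr : TransferMatrix w v) (Mr : TransferMatrix v v)
    (Ur : TransferMatrix v w) (Vr : TransferMatrix w w)
    (Nl : TransferMatrix w v) (Ml : TransferMatrix w w)
    (Ul : TransferMatrix v w) (Vl : TransferMatrix v v) : Prop where
  stable_Nr : IsRHInf Nr
  stable_Mr : IsRHInf Mr
  stable_Ur : IsRHInf Ur
  stable_Vr : IsRHInf Vr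
  stable_Nl : IsRHInf Nl
  stable_Ml : IsRHInf Ml
  stable_Ul : IsRHInf Ul
  stable_Vl : IsRHInf Vl
  isUnit_Mr : IsUnit Mr
  isUnit_Ml : IsUnit Ml
  right_factorization : G = Nr * Mr⁻¹
  left_factorization : G = Ml⁻¹ * Nl
  bezout : fromBlocks Vl (-Ul) (-Nl) Ml * fromBlocks Mr Ur Nr Vr = 1

section

variable {w y v u : Type*} [Fintype w] [Fintype y] [Fintype v] [Fintype u]
  [DecidableEq w] [DecidableEq y] [DecidableEq v] [DecidableEq u]

/-- The subsystem of interest is `(w, y) = G (v, u)`; these are its four blocks. -/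
abbrev Gwv (G : TransferMatrix (w ⊕ y) (v ⊕ u)) : TransferMatrix w v := G.toBlocks₁₁

/-- The block from `u` to `w`. -/
abbrev Gwu (G : TransferMatrix (w ⊕ y) (v ⊕ u)) : TransferMatrix w u := G.toBlocks₁₂

/-- The block from `v` to `y`. -/
abbrev Gyv (G : TransferMatrix (w ⊕ y) (v ⊕ u)) : TransferMatrix y v := G.toBlocks₂₁

/-- The block from `u` to `y`. -/
abbrev Gyu (G : TransferMatrix (w ⊕ y) (v ⊕ u)) : TransferMatrix y u := G.toBlocks₂₂

/-- The matrix of the loop equations with perturbations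
`u = K y + δ_u`, `y = Gyv v + Gyu u + δ_y`, `v = Gbar w + δ_v`, `w = Gwv v + Gwu u + δ_w`,
written as `loopMatrix (u, y, v, w) = (δ_u, δ_y, δ_v, δ_w)`. -/
noncomputable def loopMatrix (G : TransferMatrix (w ⊕ y) (v ⊕ u)) (Gbar : TransferMatrix v w)
    (K : TransferMatrix u y) : TransferMatrix ((u ⊕ y) ⊕ (v ⊕ w)) ((u ⊕ y) ⊕ (v ⊕ w)) :=
  fromBlocks
    (fromBlocks 1 (-K) (-Gyu G) 1) (fromBlocks 0 0 (-Gyv G) 0)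
    (fromBlocks 0 0 (-Gwu G) 0) (fromBlocks 1 (-Gbar) (-Gwv G) 1)

/-- Internal stability of the interconnection of `G`, `Gbar` and `K`: the loop equations are
uniquely solvable and the sixteen transfer matrices from `(δ_u, δ_y, δ_v, δ_w)` to `(u, y, v, w)`
all belong to `RH∞`. -/
def InternallyStable (G : TransferMatrix (w ⊕ y) (v ⊕ u)) (Gbar : TransferMatrix v w)
    (K : TransferMatrix u y) : Prop :=
  IsUnit (loopMatrix G Gbar K) ∧ IsRHInf (loopMatrix G Gbar K)⁻¹

/-- `Gbar` is an admissible environment: it is proper and the preexisting system, i.e. the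
interconnection of `G` and `Gbar` without the controller (`K = 0`), is internally stable. -/
def IsAdmissible (G : TransferMatrix (w ⊕ y) (v ⊕ u)) (Gbar : TransferMatrix v w) : Prop :=
  IsRP Gbar ∧ InternallyStable G Gbar 0

/-- `K` is a retrofit controller: the closed loop is internally stable for every admissible
environment. -/
def IsRetrofit (G : TransferMatrix (w ⊕ y) (v ⊕ u)) (K : TransferMatrix u y) : Prop :=
  ∀ Gbar : TransferMatrix v w, IsAdmissible G Gbar → InternallyStable G Gbar K

/-- `G̃_yu = G_yu + G_yv U_r M_l G_wu`. -/
noncomputable def tildeGyu (G : TransferMatrix (w ⊕ y) (v ⊕ u)) (Ur : TransferMatrix v w)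
    (Ml : TransferMatrix w w) : TransferMatrix y u :=
  Gyu G + Gyv G * Ur * Ml * Gwu G

/-- The modified Youla parameter `Q̃ = (I - K G̃_yu)⁻¹ K`. (For proper `K`, `Ur`, `Ml` and strictly
proper `G` the matrix `I - K G̃_yu` is the identity at infinity, hence invertible.) -/
noncomputable def tildeQ (G : TransferMatrix (w ⊕ y) (v ⊕ u)) (Ur : TransferMatrix v w)
    (Ml : TransferMatrix w w) (K : TransferMatrix u y) : TransferMatrix u y :=
  (1 - K * tildeGyu G Ur Ml)⁻¹ * K

end

end Retrofit

/-! Closing `G_wv` with an environment gives an inner loop whose map `H_vw` from `δ_w` to `v` is all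
the controller sees of it: the plant becomes `P = G_yu + G_yv H_vw G_wu`. Once the inner loop is
stable, the whole system is stable iff `Q = (1 - K P)⁻¹ K` is
(`internallyStable_iff_isRHInf_youla`). The Youla parametrization `H_vw = (U_r + M_r X) M_l` with
`X` stable covers all admissible environments (`IsEnvLoop.exists_parameter`,
`exists_isEnvLoop_of_parameter`), and turns `P` into `G̃_yu + D`, where `D = (G_yv M_r) X (M_l
G_wu)`. One admissible environment makes `G̃_yu` and both outer factors of `D` stable.

Now `Q = Q̃ + Q̃ D Q`. If `G_wu Q̃ G_yv = 0`, then `D Q̃ D = 0` and `Q = Q̃ + Q̃ D Q̃` is stable.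
Conversely, `X = 0` shows `Q̃` stable, and `(1 - D Q̃)(1 + D Q) = 1` makes `det (1 - X T)` a unit of
`RH∞` for every stable `X`, where `T = M_l G_wu Q̃ G_yv M_r`. This forces `T = 0`
(`eq_zero_of_forall_isRHInf_det_unit`). -/

namespace Retrofit

/-! ### Rings of proper and of stable rational functions. -/

section Scalars

/-- The valuation of `ℝ(s)` at the place at infinity. -/
noncomputable abbrev inftyValuation : Valuation (RatFunc ℝ) (WithZero (Multiplicative ℤ)) :=
  open Classical in RatFunc.inftyValuation ℝ

theorem isProper_iff_inftyValuation_le_one (r : RatFunc ℝ) :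
    IsProper r ↔ inftyValuation r ≤ 1 := by
  classical
  by_cases hr : r = 0
  · subst hr
    simp [IsProper]
  · rw [RatFunc.inftyValuation_apply, RatFunc.inftyValuation_of_nonzero _ hr, ← WithZero.exp_zero,
      WithZero.exp_le_exp, RatFunc.intDegree, IsProper,
      Polynomial.degree_eq_natDegree (RatFunc.num_ne_zero hr),
      Polynomial.degree_eq_natDegree r.denom_ne_zero, Nat.cast_le]
    omega

theorem isStrictlyProper_iff_inftyValuation_lt_one (r : RatFunc ℝ) :
    IsStrictlyProper r ↔ inftyValuation r < 1 := by
  classical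
  by_cases hr : r = 0
  · subst hr
    simp [IsStrictlyProper]
  · rw [RatFunc.inftyValuation_apply, RatFunc.inftyValuation_of_nonzero _ hr, ← WithZero.exp_zero,
      WithZero.exp_lt_exp, RatFunc.intDegree, IsStrictlyProper,
      Polynomial.degree_eq_natDegree (RatFunc.num_ne_zero hr),
      Polynomial.degree_eq_natDegree r.denom_ne_zero, Nat.cast_lt]
    omega

/-- The proper real rational functions form the valuation ring of the place at infinity. -/
noncomputable def properSubring : Subring (RatFunc ℝ) where
  carrier := {r | IsProper r}
  zero_mem' := by simp [isProper_iff_inftyValuation_le_one]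
  one_mem' := by simp [isProper_iff_inftyValuation_le_one]
  add_mem' {a b} ha hb := by
    simp only [Set.mem_ofPred_eq, isProper_iff_inftyValuation_le_one] at *
    exact inftyValuation.map_add_le ha hb
  mul_mem' {a b} ha hb := by
    simp only [Set.mem_ofPred_eq, isProper_iff_inftyValuation_le_one, map_mul] at *
    exact mul_le_one' ha hb
  neg_mem' {a} ha := by
    simpa only [Set.mem_ofPred_eq, isProper_iff_inftyValuation_le_one, Valuation.map_neg] using ha

theorem HasStablePoles.of_denom_dvd {r : RatFunc ℝ} {p : Polynomial ℝ} (h : r.denom ∣ p)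
    (hp : ∀ s : ℂ, Polynomial.aeval s p = 0 → s.re < 0) : HasStablePoles r := by
  intro s hs
  obtain ⟨q, rfl⟩ := h
  exact hp s (by rw [map_mul, hs, zero_mul])

theorem HasStablePoles.aeval_denom_mul {a b : RatFunc ℝ} (ha : HasStablePoles a)
    (hb : HasStablePoles b) (s : ℂ) (hs : Polynomial.aeval s (a.denom * b.denom) = 0) :
    s.re < 0 := by
  rw [map_mul, mul_eq_zero] at hs
  exact hs.elim (ha s) (hb s)

theorem hasStablePoles_C (c : ℝ) : HasStablePoles (RatFunc.C c) := by
  intro s hs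
  simp at hs

theorem HasStablePoles.mul {a b : RatFunc ℝ} (ha : HasStablePoles a) (hb : HasStablePoles b) :
    HasStablePoles (a * b) :=
  .of_denom_dvd (RatFunc.denom_mul_dvd a b) (ha.aeval_denom_mul hb)

theorem HasStablePoles.add {a b : RatFunc ℝ} (ha : HasStablePoles a) (hb : HasStablePoles b) :
    HasStablePoles (a + b) :=
  .of_denom_dvd (RatFunc.denom_add_dvd a b) (ha.aeval_denom_mul hb)

/-- The proper stable real rational functions. -/
noncomputable def stableSubring : Subring (RatFunc ℝ) where
  carrier := {r | IsProper r ∧ HasStablePoles r}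
  zero_mem' := ⟨properSubring.zero_mem, by simpa using hasStablePoles_C 0⟩
  one_mem' := ⟨properSubring.one_mem, by simpa using hasStablePoles_C 1⟩
  add_mem' ha hb := ⟨properSubring.add_mem ha.1 hb.1, ha.2.add hb.2⟩
  mul_mem' ha hb := ⟨properSubring.mul_mem ha.1 hb.1, ha.2.mul hb.2⟩
  neg_mem' {a} ha := ⟨properSubring.neg_mem ha.1, by
    simpa using (hasStablePoles_C (-1)).mul ha.2⟩

theorem C_mem_stableSubring (c : ℝ) : RatFunc.C c ∈ stableSubring := by
  refine ⟨?_, hasStablePoles_C c⟩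
  rw [IsProper, RatFunc.num_C, RatFunc.denom_C, Polynomial.degree_one]
  exact Polynomial.degree_C_le

/-- Supplies the side conditions under which `RatFunc.eval` respects sums and products. -/
theorem eval_denom_ne_zero_of_mem_stableSubring {r : RatFunc ℝ} (hr : r ∈ stableSubring) {s : ℝ}
    (hs : 0 ≤ s) : Polynomial.eval₂ (RingHom.id ℝ) s r.denom ≠ 0 := by
  intro h
  have := hr.2 (s : ℂ) (by
    rw [← Complex.coe_algebraMap, Polynomial.aeval_algebraMap_apply]
    simpa [Polynomial.eval₂_eq_eval_map, ← Polynomial.coe_aeval_eq_eval] using h)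
  simp at this
  linarith

/-- A nonzero stable function `t` is not in the Jacobson radical of the ring of stable functions,
since `1 - t / t(s)` vanishes at a point `s` of the right half plane with `t(s) ≠ 0`. -/
theorem exists_one_sub_C_mul_not_unit {t : RatFunc ℝ} (ht : t ∈ stableSubring) (ht0 : t ≠ 0) :
    ∃ c : ℝ, ∀ d ∈ stableSubring, (1 - RatFunc.C c * t) * d ≠ 1 := by
  obtain ⟨s, hs0, hs⟩ : ∃ s : ℝ, 0 < s ∧ t.num.eval s ≠ 0 := by
    obtain ⟨s, hs, hs'⟩ := ((Set.Ioi_infinite (0 : ℝ)).sdiff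
      t.num.roots.toFinset.finite_toSet).nonempty
    refine ⟨s, hs, fun h => hs' ?_⟩
    simpa [RatFunc.num_ne_zero ht0] using h
  have hev : RatFunc.eval (RingHom.id ℝ) s t ≠ 0 := by
    rw [RatFunc.eval]
    exact div_ne_zero (by simpa [Polynomial.eval₂_eq_eval_map] using hs)
      (eval_denom_ne_zero_of_mem_stableSubring ht hs0.le)
  set c : ℝ := (RatFunc.eval (RingHom.id ℝ) s t)⁻¹ with hc
  refine ⟨c, fun d hd h => ?_⟩
  have hct := stableSubring.mul_mem (C_mem_stableSubring (-c)) ht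
  have hsum := stableSubring.add_mem stableSubring.one_mem hct
  have key := congrArg (RatFunc.eval (RingHom.id ℝ) s) h
  rw [sub_eq_add_neg, ← neg_mul, ← map_neg,
    RatFunc.eval_mul _ _ (eval_denom_ne_zero_of_mem_stableSubring hsum hs0.le)
      (eval_denom_ne_zero_of_mem_stableSubring hd hs0.le),
    RatFunc.eval_add _ _ (eval_denom_ne_zero_of_mem_stableSubring stableSubring.one_mem hs0.le)
      (eval_denom_ne_zero_of_mem_stableSubring hct hs0.le),
    RatFunc.eval_mul _ _
      (eval_denom_ne_zero_of_mem_stableSubring (C_mem_stableSubring (-c)) hs0.le)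
      (eval_denom_ne_zero_of_mem_stableSubring ht hs0.le), RatFunc.eval_one, RatFunc.eval_C,
    RingHom.id_apply, hc, neg_mul, inv_mul_cancel₀ hev] at key
  simp at key

end Scalars

/-! ### Matrices over these rings. -/

section Entries

variable {l m n o : Type*} {A A' : TransferMatrix l m} {B : TransferMatrix m n}

theorem mul_apply_mem [Fintype m] {R : Type*} [CommRing R] {S : Subring R} {A : Matrix l m R}
    {B : Matrix m n R} (hA : ∀ i j, A i j ∈ S) (hB : ∀ i j, B i j ∈ S) (i : l) (j : n) :
    (A * B) i j ∈ S := by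
  rw [Matrix.mul_apply]
  exact S.sum_mem fun k _ => S.mul_mem (hA i k) (hB k j)

theorem one_apply_mem [DecidableEq m] {R : Type*} [CommRing R] (S : Subring R) (i j : m) :
    (1 : Matrix m m R) i j ∈ S := by
  rw [Matrix.one_apply]
  split_ifs
  exacts [S.one_mem, S.zero_mem]

theorem det_mem [Fintype m] [DecidableEq m] {R : Type*} [CommRing R] {S : Subring R}
    {A : Matrix m m R} (hA : ∀ i j, A i j ∈ S) : A.det ∈ S := by
  rw [Matrix.det_apply]
  exact S.sum_mem fun σ _ => S.zsmul_mem (S.prod_mem fun i _ => hA _ _) _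

theorem IsRP.mul [Fintype m] (hA : IsRP A) (hB : IsRP B) : IsRP (A * B) :=
  mul_apply_mem (S := properSubring) hA hB

theorem IsRHInf.isRP (hA : IsRHInf A) : IsRP A := fun i j => (hA i j).1

theorem IsRHInf.mul [Fintype m] (hA : IsRHInf A) (hB : IsRHInf B) : IsRHInf (A * B) :=
  mul_apply_mem (S := stableSubring) hA hB

theorem IsRHInf.add (hA : IsRHInf A) (hA' : IsRHInf A') : IsRHInf (A + A') :=
  fun i j => stableSubring.add_mem (hA i j) (hA' i j)

theorem IsRHInf.sub (hA : IsRHInf A) (hA' : IsRHInf A') : IsRHInf (A - A') :=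
  fun i j => stableSubring.sub_mem (hA i j) (hA' i j)

theorem isRHInf_zero : IsRHInf (0 : TransferMatrix l m) :=
  fun _ _ => stableSubring.zero_mem

theorem isRHInf_one [DecidableEq m] : IsRHInf (1 : TransferMatrix m m) :=
  one_apply_mem stableSubring

theorem isRHInf_fromBlocks {A : TransferMatrix n l} {B : TransferMatrix n m}
    {C : TransferMatrix o l} {D : TransferMatrix o m} :
    IsRHInf (fromBlocks A B C D) ↔ (IsRHInf A ∧ IsRHInf B) ∧ IsRHInf C ∧ IsRHInf D := by
  simp only [IsRHInf, Sum.forall, fromBlocks_apply₁₁, fromBlocks_apply₁₂, fromBlocks_apply₂₁,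
    fromBlocks_apply₂₂, forall_and]
  tauto

theorem isStrictRP_iff :
    IsStrictRP A ↔ ∀ i j, inftyValuation (A i j) < 1 := by
  simp only [IsStrictRP, isStrictlyProper_iff_inftyValuation_lt_one]

theorem isRP_iff : IsRP A ↔ ∀ i j, inftyValuation (A i j) ≤ 1 := by
  simp only [IsRP, isProper_iff_inftyValuation_le_one]

theorem IsStrictRP.isRP (hA : IsStrictRP A) : IsRP A :=
  isRP_iff.2 fun i j => (isStrictRP_iff.1 hA i j).le

theorem IsStrictRP.add (hA : IsStrictRP A) (hA' : IsStrictRP A') : IsStrictRP (A + A') :=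
  isStrictRP_iff.2 fun i j =>
    inftyValuation.map_add_lt (isStrictRP_iff.1 hA i j) (isStrictRP_iff.1 hA' i j)

theorem IsStrictRP.neg (hA : IsStrictRP A) : IsStrictRP (-A) :=
  isStrictRP_iff.2 fun i j => by
    simpa only [Matrix.neg_apply, Valuation.map_neg] using isStrictRP_iff.1 hA i j

theorem IsStrictRP.mul_isRP [Fintype m] (hA : IsStrictRP A) (hB : IsRP B) : IsStrictRP (A * B) :=
  isStrictRP_iff.2 fun i j => by
    rw [Matrix.mul_apply]
    refine inftyValuation.map_sum_lt one_ne_zero fun k _ => ?_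
    rw [map_mul]
    exact mul_lt_one_of_lt_of_le (isStrictRP_iff.1 hA i k) (isRP_iff.1 hB k j)

theorem IsRP.mul_isStrictRP [Fintype m] (hA : IsRP A) (hB : IsStrictRP B) : IsStrictRP (A * B) :=
  isStrictRP_iff.2 fun i j => by
    rw [Matrix.mul_apply]
    refine inftyValuation.map_sum_lt one_ne_zero fun k _ => ?_
    rw [map_mul]
    rw [mul_comm]
    exact mul_lt_one_of_lt_of_le (isStrictRP_iff.1 hB k j) (isRP_iff.1 hA i k)

/-- A square proper matrix which is the identity at infinity has a proper inverse. -/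
theorem IsStrictRP.exists_one_sub_mul_eq_one [Fintype m] [DecidableEq m] {Z : TransferMatrix m m}
    (hZ : IsStrictRP Z) : ∃ W : TransferMatrix m m, IsRP W ∧ (1 - Z) * W = 1 := by
  let O := inftyValuation.valuationSubring
  let Z' : Matrix m m O := Matrix.of fun i j => ⟨Z i j, (isStrictRP_iff.1 hZ i j).le⟩
  -- Strictly proper entries lie in the maximal ideal of the valuation ring, so `det (1 - Z')` has
  -- residue 1 and is a unit.
  have hres : (IsLocalRing.residue O).mapMatrix Z' = 0 := by
    ext i j
    rw [RingHom.mapMatrix_apply, Matrix.map_apply, Matrix.zero_apply, IsLocalRing.residue_eq_zero_iff,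
      IsLocalRing.mem_maximalIdeal, mem_nonunits_iff]
    intro h
    obtain ⟨b, hb⟩ := h.exists_right_inv
    have h1 : inftyValuation (Z i j) * inftyValuation (b : RatFunc ℝ) = 1 := by
      rw [← map_mul, show Z i j * (b : RatFunc ℝ) = 1 from congrArg Subtype.val hb, map_one]
    exact (mul_lt_one_of_lt_of_le (isStrictRP_iff.1 hZ i j) b.2).ne h1
  have hdet : IsUnit (1 - Z').det := by
    rw [← IsLocalRing.residue_ne_zero_iff_isUnit, RingHom.map_det, map_sub, hres, map_one, sub_zero,
      det_one]
    exact one_ne_zero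
  have hmap : O.subtype.mapMatrix Z' = Z := rfl
  refine ⟨O.subtype.mapMatrix (1 - Z')⁻¹, isRP_iff.2 fun i j => ((1 - Z')⁻¹ i j).2, ?_⟩
  have := congrArg O.subtype.mapMatrix (Matrix.mul_nonsing_inv _ hdet)
  rwa [map_mul, map_sub, map_one, hmap] at this

end Entries

/-! ### Closed loop in terms of the inner loop and `Q`. -/

section ClosedLoop

/-- Shape of the block identities below: a defining relation times a right factor, plus possibly a
second relation. -/
theorem mul_add_eq_zero {l m n : Type*} [Fintype m] {A : TransferMatrix l m}
    {C : TransferMatrix l n} (hA : A = 0) (B : TransferMatrix m n) (hC : C = 0) :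
    A * B + C = 0 := by
  rw [hA, Matrix.zero_mul, hC, add_zero]

variable {w y v u : Type*} [Fintype w] [Fintype y] [Fintype v] [Fintype u]
  [DecidableEq w] [DecidableEq y] [DecidableEq v] [DecidableEq u]

/-- The transfer matrix from `u` to `y` seen by the controller when `Hvw` is the transfer matrix
from `δ_w` to `v` of the loop of `G_wv` and the environment. -/
noncomputable def plant (G : TransferMatrix (w ⊕ y) (v ⊕ u)) (Hvw : TransferMatrix v w) :
    TransferMatrix y u :=
  Gyu G + Gyv G * Hvw * Gwu G

/-- The entries of the inverse of `[1, -Gbar; -Gwv, 1]`. -/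
structure IsEnvLoop (G : TransferMatrix (w ⊕ y) (v ⊕ u)) (Gbar : TransferMatrix v w)
    (Hvv : TransferMatrix v v) (Hvw : TransferMatrix v w)
    (Hwv : TransferMatrix w v) (Hww : TransferMatrix w w) : Prop where
  vv : Hvv = 1 + Gbar * Hwv
  vw : Hvw = Gbar * Hww
  wv : Hwv = Gwv G * Hvv
  ww : Hww = 1 + Gwv G * Hvw
  vv_comm : Hvv = 1 + Hvw * Gwv G

/-- The transfer matrix from `(δ_u, δ_y, δ_v, δ_w)` to `(u, y, v, w)` in terms of the inner loop and
the Youla parameter `Q = (1 - K P)⁻¹ K`. -/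
noncomputable def closedLoop (G : TransferMatrix (w ⊕ y) (v ⊕ u))
    (Hvv : TransferMatrix v v) (Hvw : TransferMatrix v w)
    (Hwv : TransferMatrix w v) (Hww : TransferMatrix w w) (Q : TransferMatrix u y) :
    TransferMatrix ((u ⊕ y) ⊕ (v ⊕ w)) ((u ⊕ y) ⊕ (v ⊕ w)) :=
  fromBlocks
    (fromBlocks (1 + Q * plant G Hvw) Q
      (plant G Hvw * (1 + Q * plant G Hvw)) (1 + plant G Hvw * Q))
    (fromBlocks (Q * (Gyv G * Hvv)) (Q * (Gyv G * Hvw))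
      ((1 + plant G Hvw * Q) * (Gyv G * Hvv)) ((1 + plant G Hvw * Q) * (Gyv G * Hvw)))
    (fromBlocks (Hvw * Gwu G * (1 + Q * plant G Hvw)) (Hvw * Gwu G * Q)
      (Hww * Gwu G * (1 + Q * plant G Hvw)) (Hww * Gwu G * Q))
    (fromBlocks (Hvv + Hvw * Gwu G * Q * (Gyv G * Hvv)) (Hvw + Hvw * Gwu G * Q * (Gyv G * Hvw))
      (Hwv + Hww * Gwu G * Q * (Gyv G * Hvv)) (Hww + Hww * Gwu G * Q * (Gyv G * Hvw)))

variable {G : TransferMatrix (w ⊕ y) (v ⊕ u)} {Gbar : TransferMatrix v w}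
  {Hvv : TransferMatrix v v} {Hvw : TransferMatrix v w}
  {Hwv : TransferMatrix w v} {Hww : TransferMatrix w w} {K Q : TransferMatrix u y}

theorem loopMatrix_mul_closedLoop (hH : IsEnvLoop G Gbar Hvv Hvw Hwv Hww)
    (hQ : Q = K * (1 + plant G Hvw * Q)) :
    loopMatrix G Gbar K * closedLoop G Hvv Hvw Hwv Hww Q = 1 := by
  have hvv : Hvv - (1 + Gbar * Hwv) = 0 := sub_eq_zero.2 hH.vv
  have hvw : Hvw - Gbar * Hww = 0 := sub_eq_zero.2 hH.vw
  have hwv : Hwv - Gwv G * Hvv = 0 := sub_eq_zero.2 hH.wv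
  have hww : Hww - (1 + Gwv G * Hvw) = 0 := sub_eq_zero.2 hH.ww
  have hK : Q - K * (1 + plant G Hvw * Q) = 0 := sub_eq_zero.2 hQ
  have hP : plant G Hvw - Gyu G - Gyv G * (Hvw * Gwu G) = 0 := by
    rw [plant, ← Matrix.mul_assoc]; abel
  set P := plant G Hvw with hPdef
  have hblocks : (1 : TransferMatrix ((u ⊕ y) ⊕ (v ⊕ w)) ((u ⊕ y) ⊕ (v ⊕ w))) =
      fromBlocks (fromBlocks 1 0 0 1) (fromBlocks 0 0 0 0) (fromBlocks 0 0 0 0)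
        (fromBlocks 1 0 0 1) := by
    simp only [fromBlocks_one, fromBlocks_zero]
  rw [hblocks, loopMatrix, closedLoop, ← hPdef]
  simp only [fromBlocks_multiply, fromBlocks_add, Matrix.one_mul, Matrix.zero_mul, Matrix.neg_mul,
    add_zero, zero_add]
  congr 2 <;> [
    refine eq_of_sub_eq_zero (Eq.trans ?_ (mul_add_eq_zero hK P rfl));
    refine eq_of_sub_eq_zero (Eq.trans ?_ (mul_add_eq_zero hK 1 rfl));
    refine eq_of_sub_eq_zero (Eq.trans ?_ (mul_add_eq_zero hP (1 + Q * P) rfl));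
    refine eq_of_sub_eq_zero (Eq.trans ?_ (mul_add_eq_zero hP Q rfl));
    refine eq_of_sub_eq_zero (Eq.trans ?_ (mul_add_eq_zero hK (Gyv G * Hvv) rfl));
    refine eq_of_sub_eq_zero (Eq.trans ?_ (mul_add_eq_zero hK (Gyv G * Hvw) rfl));
    refine eq_of_sub_eq_zero (Eq.trans ?_ (mul_add_eq_zero hP (Q * (Gyv G * Hvv)) rfl));
    refine eq_of_sub_eq_zero (Eq.trans ?_ (mul_add_eq_zero hP (Q * (Gyv G * Hvw)) rfl));
    refine eq_of_sub_eq_zero (Eq.trans ?_ (mul_add_eq_zero hvw (Gwu G * (1 + Q * P)) rfl));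
    refine eq_of_sub_eq_zero (Eq.trans ?_ (mul_add_eq_zero hvw (Gwu G * Q) rfl));
    refine eq_of_sub_eq_zero (Eq.trans ?_ (mul_add_eq_zero hww (Gwu G * (1 + Q * P)) rfl));
    refine eq_of_sub_eq_zero (Eq.trans ?_ (mul_add_eq_zero hww (Gwu G * Q) rfl));
    refine eq_of_sub_eq_zero (Eq.trans ?_ (mul_add_eq_zero hvw (Gwu G * Q * (Gyv G * Hvv)) hvv));
    refine eq_of_sub_eq_zero (Eq.trans ?_ (mul_add_eq_zero hvw (Gwu G * Q * (Gyv G * Hvw)) hvw));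
    refine eq_of_sub_eq_zero (Eq.trans ?_ (mul_add_eq_zero hww (Gwu G * Q * (Gyv G * Hvv)) hwv));
    refine eq_of_sub_eq_zero (Eq.trans ?_ (mul_add_eq_zero hww (Gwu G * Q * (Gyv G * Hvw)) hww))]
  all_goals simp only [Matrix.mul_add, Matrix.add_mul, Matrix.sub_mul, Matrix.mul_assoc,
    Matrix.mul_one, Matrix.one_mul]
  all_goals abel

/-- A one-sided inverse of a square matrix is its inverse, so unique solvability is automatic. -/
theorem internallyStable_iff_isRHInf_closedLoop (hH : IsEnvLoop G Gbar Hvv Hvw Hwv Hww)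
    (hQ : Q = K * (1 + plant G Hvw * Q)) :
    InternallyStable G Gbar K ↔ IsRHInf (closedLoop G Hvv Hvw Hwv Hww Q) := by
  have h := loopMatrix_mul_closedLoop hH hQ
  rw [InternallyStable, Matrix.inv_eq_right_inv h]
  exact and_iff_right (IsUnit.of_mul_eq_one _ h)

/-- Stability of the inner loop, together with its interaction with the subsystem. -/
structure IsStableEnvLoop (G : TransferMatrix (w ⊕ y) (v ⊕ u))
    (Hvv : TransferMatrix v v) (Hvw : TransferMatrix v w)
    (Hwv : TransferMatrix w v) (Hww : TransferMatrix w w) : Prop where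
  plant : IsRHInf (plant G Hvw)
  yv : IsRHInf (Gyv G * Hvv)
  yw : IsRHInf (Gyv G * Hvw)
  vu : IsRHInf (Hvw * Gwu G)
  wu : IsRHInf (Hww * Gwu G)
  vv : IsRHInf Hvv
  vw : IsRHInf Hvw
  wv : IsRHInf Hwv
  ww : IsRHInf Hww

theorem internallyStable_zero_iff (hH : IsEnvLoop G Gbar Hvv Hvw Hwv Hww) :
    InternallyStable G Gbar 0 ↔ IsStableEnvLoop G Hvv Hvw Hwv Hww := by
  rw [internallyStable_iff_isRHInf_closedLoop (Q := 0) hH (by rw [Matrix.zero_mul])]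
  simp only [closedLoop, isRHInf_fromBlocks, Matrix.zero_mul, Matrix.mul_zero, add_zero,
    Matrix.mul_one, Matrix.one_mul]
  constructor
  · rintro ⟨⟨⟨-, hp, -⟩, -, hyv, hyw⟩, ⟨⟨hvu, -⟩, hwu, -⟩, ⟨hvv, hvw⟩, hwv, hww⟩
    exact ⟨hp, hyv, hyw, hvu, hwu, hvv, hvw, hwv, hww⟩
  · rintro ⟨hp, hyv, hyw, hvu, hwu, hvv, hvw, hwv, hww⟩
    exact ⟨⟨⟨⟨isRHInf_one, isRHInf_zero⟩, hp, isRHInf_one⟩, ⟨isRHInf_zero, isRHInf_zero⟩, hyv, hyw⟩,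
      ⟨⟨hvu, isRHInf_zero⟩, hwu, isRHInf_zero⟩, ⟨hvv, hvw⟩, hwv, hww⟩

/-- `Q` is itself the block from `δ_y` to `u`; every other block is a polynomial in `Q` and the
stable data of the inner loop. -/
theorem internallyStable_iff_isRHInf_youla (hH : IsEnvLoop G Gbar Hvv Hvw Hwv Hww)
    (hS : IsStableEnvLoop G Hvv Hvw Hwv Hww) (hQ : Q = K * (1 + plant G Hvw * Q)) :
    InternallyStable G Gbar K ↔ IsRHInf Q := by
  rw [internallyStable_iff_isRHInf_closedLoop hH hQ]
  simp only [closedLoop, isRHInf_fromBlocks]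
  refine ⟨fun h => h.1.1.1.2, fun hQ => ?_⟩
  have h1 := isRHInf_one.add (hQ.mul hS.plant)
  have h2 := isRHInf_one.add (hS.plant.mul hQ)
  exact ⟨⟨⟨⟨h1, hQ⟩, hS.plant.mul h1, h2⟩, ⟨hQ.mul hS.yv, hQ.mul hS.yw⟩, h2.mul hS.yv, h2.mul hS.yw⟩,
    ⟨⟨hS.vu.mul h1, hS.vu.mul hQ⟩, hS.wu.mul h1, hS.wu.mul hQ⟩,
    ⟨hS.vv.add ((hS.vu.mul hQ).mul hS.yv), hS.vw.add ((hS.vu.mul hQ).mul hS.yw)⟩,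
    hS.wv.add ((hS.wu.mul hQ).mul hS.yv), hS.ww.add ((hS.wu.mul hQ).mul hS.yw)⟩

theorem exists_isEnvLoop (hG : IsStrictRP (Gwv G)) (hGbar : IsRP Gbar) :
    ∃ (Hvv : TransferMatrix v v) (Hvw : TransferMatrix v w) (Hwv : TransferMatrix w v)
      (Hww : TransferMatrix w w), IsEnvLoop G Gbar Hvv Hvw Hwv Hww := by
  obtain ⟨W, -, hW⟩ := (hG.mul_isRP hGbar).exists_one_sub_mul_eq_one
  rw [Matrix.sub_mul, Matrix.one_mul, sub_eq_iff_eq_add, Matrix.mul_assoc] at hW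
  -- Here `W` is the inverse of `1 - G_wv Gbar`.
  refine ⟨1 + Gbar * (W * Gwv G), Gbar * W, W * Gwv G, W, rfl, rfl, ?_, hW, ?_⟩
  · rw [Matrix.mul_add, Matrix.mul_one]
    nth_rw 1 [hW]
    rw [Matrix.add_mul, Matrix.one_mul]
    simp only [Matrix.mul_assoc]
  · rw [Matrix.mul_assoc]

theorem IsStrictRP.plant (hG : IsStrictRP G) (hH : IsRP Hvw) : IsStrictRP (plant G Hvw) := by
  have hyu : IsStrictRP (Gyu G) := fun i j => hG _ _
  have hyv : IsStrictRP (Gyv G) := fun i j => hG _ _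
  have hwu : IsStrictRP (Gwu G) := fun i j => hG _ _
  exact hyu.add ((hyv.mul_isRP hH).mul_isRP hwu.isRP)

theorem isUnit_one_sub_mul {P : TransferMatrix y u} (hP : IsStrictRP P) (hK : IsRP K) :
    IsUnit (1 - K * P) := by
  obtain ⟨W, -, hW⟩ := (hK.mul_isStrictRP hP).exists_one_sub_mul_eq_one
  exact IsUnit.of_mul_eq_one _ hW

/-- The fixed-point form allows a candidate `Q` to be verified without computing an inverse. -/
theorem eq_inv_mul_iff {P : TransferMatrix y u} (h : IsUnit (1 - K * P)) :
    Q = (1 - K * P)⁻¹ * K ↔ Q = K * (1 + P * Q) := by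
  have hdet := (Matrix.isUnit_iff_isUnit_det _).1 h
  have key : Q = K * (1 + P * Q) ↔ (1 - K * P) * Q = K := by
    rw [Matrix.sub_mul, Matrix.one_mul, sub_eq_iff_eq_add, Matrix.mul_add, Matrix.mul_one,
      Matrix.mul_assoc]
  rw [key]
  constructor
  · rintro rfl
    rw [Matrix.mul_nonsing_inv_cancel_left _ _ hdet]
  · intro h
    nth_rw 2 [← h]
    rw [Matrix.nonsing_inv_mul_cancel_left _ _ hdet]

/-- The effect on the Youla parameter of an additive perturbation of the plant. -/
theorem inv_mul_add_perturbation {P D : TransferMatrix y u} (h : IsUnit (1 - K * P))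
    (hQ : Q = K * (1 + (P + D) * Q)) :
    Q = (1 - K * P)⁻¹ * K + (1 - K * P)⁻¹ * K * (D * Q) := by
  have hdet := (Matrix.isUnit_iff_isUnit_det _).1 h
  have key : (1 - K * P) * Q = K * (1 + D * Q) := by
    rw [Matrix.sub_mul, Matrix.one_mul, sub_eq_iff_eq_add]
    nth_rw 1 [hQ]
    simp only [Matrix.mul_add, Matrix.add_mul, Matrix.mul_assoc]
    abel
  have := congrArg ((1 - K * P)⁻¹ * ·) key
  simp only [Matrix.nonsing_inv_mul_cancel_left _ _ hdet] at this
  rwa [← Matrix.mul_assoc, Matrix.mul_add, Matrix.mul_one] at this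

end ClosedLoop

/-! ### Youla parametrization of the admissible environments. -/

section Coprime

variable {w y v u : Type*} [Fintype w] [Fintype y] [Fintype v] [Fintype u]
  [DecidableEq w] [DecidableEq y] [DecidableEq v] [DecidableEq u]

namespace IsDoublyCoprime

variable {F : TransferMatrix w v}
  {Nr : TransferMatrix w v} {Mr : TransferMatrix v v}
  {Ur : TransferMatrix v w} {Vr : TransferMatrix w w}
  {Nl : TransferMatrix w v} {Ml : TransferMatrix w w}
  {Ul : TransferMatrix v w} {Vl : TransferMatrix v v}

theorem mul_Mr (h : IsDoublyCoprime F Nr Mr Ur Vr Nl Ml Ul Vl) : F * Mr = Nr := by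
  rw [h.right_factorization,
    Matrix.nonsing_inv_mul_cancel_right _ _ ((Matrix.isUnit_iff_isUnit_det _).1 h.isUnit_Mr)]

theorem Ml_mul (h : IsDoublyCoprime F Nr Mr Ur Vr Nl Ml Ul Vl) : Ml * F = Nl := by
  rw [h.left_factorization,
    Matrix.mul_nonsing_inv_cancel_left _ _ ((Matrix.isUnit_iff_isUnit_det _).1 h.isUnit_Ml)]

theorem right_bezout (h : IsDoublyCoprime F Nr Mr Ur Vr Nl Ml Ul Vl) :
    Vl * Mr = 1 + Ul * Nr := by
  have := h.bezout
  rw [fromBlocks_multiply, ← fromBlocks_one, fromBlocks_inj] at this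
  rw [← this.1, Matrix.neg_mul]; abel

theorem left_bezout (h : IsDoublyCoprime F Nr Mr Ur Vr Nl Ml Ul Vl) :
    Ml * Vr = 1 + Nl * Ur := by
  have := h.bezout
  rw [fromBlocks_multiply, ← fromBlocks_one, fromBlocks_inj] at this
  rw [← this.2.2.2, Matrix.neg_mul]; abel

/-- The reversed product gives four further identities, among them the ones exchanging left and
right factors. -/
theorem bezout_comm (h : IsDoublyCoprime F Nr Mr Ur Vr Nl Ml Ul Vl) :
    fromBlocks Mr Ur Nr Vr * fromBlocks Vl (-Ul) (-Nl) Ml = 1 :=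
  mul_eq_one_comm.1 h.bezout

theorem Mr_mul_Vl (h : IsDoublyCoprime F Nr Mr Ur Vr Nl Ml Ul Vl) :
    Mr * Vl = 1 + Ur * Nl := by
  have := h.bezout_comm
  rw [fromBlocks_multiply, ← fromBlocks_one, fromBlocks_inj] at this
  rw [← this.1, Matrix.mul_neg]; abel

theorem Ur_mul_Ml (h : IsDoublyCoprime F Nr Mr Ur Vr Nl Ml Ul Vl) :
    Ur * Ml = Mr * Ul := by
  have := h.bezout_comm
  rw [fromBlocks_multiply, ← fromBlocks_one, fromBlocks_inj] at this
  have h2 := this.2.1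
  rw [Matrix.mul_neg, neg_add_eq_zero] at h2
  exact h2.symm

theorem Vr_mul_Ml (h : IsDoublyCoprime F Nr Mr Ur Vr Nl Ml Ul Vl) :
    Vr * Ml = 1 + F * (Ur * Ml) := by
  have := h.bezout_comm
  rw [fromBlocks_multiply, ← fromBlocks_one, fromBlocks_inj] at this
  rw [h.Ur_mul_Ml, ← Matrix.mul_assoc, h.mul_Mr, ← this.2.2.2, Matrix.mul_neg]; abel

theorem Mr_mul_Vl_sub (h : IsDoublyCoprime F Nr Mr Ur Vr Nl Ml Ul Vl) :
    Mr * (Vl - Ul * F) = 1 := by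
  rw [mul_eq_one_comm, Matrix.sub_mul, Matrix.mul_assoc, h.mul_Mr, h.right_bezout,
    add_sub_cancel_right]

end IsDoublyCoprime

variable {G : TransferMatrix (w ⊕ y) (v ⊕ u)} {Gbar : TransferMatrix v w}
  {Hvv : TransferMatrix v v} {Hvw : TransferMatrix v w}
  {Hwv : TransferMatrix w v} {Hww : TransferMatrix w w}
  {Nr : TransferMatrix w v} {Mr : TransferMatrix v v}
  {Ur : TransferMatrix v w} {Vr : TransferMatrix w w}
  {Nl : TransferMatrix w v} {Ml : TransferMatrix w w}
  {Ul : TransferMatrix v w} {Vl : TransferMatrix v v}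

/-- Every stable inner loop arises from a stable Youla parameter. -/
theorem IsEnvLoop.exists_parameter (hH : IsEnvLoop G Gbar Hvv Hvw Hwv Hww)
    (hS : IsStableEnvLoop G Hvv Hvw Hwv Hww)
    (h : IsDoublyCoprime (Gwv G) Nr Mr Ur Vr Nl Ml Ul Vl) :
    ∃ X : TransferMatrix v w, IsRHInf X ∧ Hvw = (Ur + Mr * X) * Ml := by
  -- Solving `Hvw = U Ml`, `Hvv = 1 + U Nl` with `U = Ur + Mr X` gives `Mr X = Hvw Vr - Hvv Ur`.
  -- Since `Mr⁻¹ = Vl - Ul G_wv`, the possibly unstable `G_wv` is absorbed through `G_wv Hvw = Hww -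
  -- 1` and `G_wv Hvv = Hwv`.
  have hX : Vl * (Hvw * Vr - Hvv * Ur) - Ul * ((Hww - 1) * Vr - Hwv * Ur) =
      (Vl - Ul * Gwv G) * (Hvw * Vr - Hvv * Ur) := by
    rw [hH.ww, hH.wv, add_sub_cancel_left]
    simp only [Matrix.sub_mul, Matrix.mul_sub, Matrix.mul_assoc]
    abel
  refine ⟨Vl * (Hvw * Vr - Hvv * Ur) - Ul * ((Hww - 1) * Vr - Hwv * Ur), ?_, ?_⟩
  · exact (h.stable_Vl.mul ((hS.vw.mul h.stable_Vr).sub (hS.vv.mul h.stable_Ur))).sub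
      (h.stable_Ul.mul (((hS.ww.sub isRHInf_one).mul h.stable_Vr).sub (hS.wv.mul h.stable_Ur)))
  · rw [hX, ← Matrix.mul_assoc, h.Mr_mul_Vl_sub, Matrix.one_mul, hH.vv_comm]
    simp only [Matrix.add_mul, Matrix.sub_mul, Matrix.one_mul, Matrix.mul_assoc, h.Vr_mul_Ml,
      Matrix.mul_add, Matrix.mul_one]
    abel

/-- Insert `1 = Hvv - Hvw G_wv` between the factors and use `G_wv Mr = Nr`; the next lemma is dual.
-/
theorem IsStableEnvLoop.isRHInf_Gyv_mul_Mr (hS : IsStableEnvLoop G Hvv Hvw Hwv Hww)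
    (hH : IsEnvLoop G Gbar Hvv Hvw Hwv Hww)
    (h : IsDoublyCoprime (Gwv G) Nr Mr Ur Vr Nl Ml Ul Vl) : IsRHInf (Gyv G * Mr) := by
  have e : Gyv G * Mr = Gyv G * Hvv * Mr - Gyv G * Hvw * Nr := by
    rw [hH.vv_comm, ← h.mul_Mr]
    simp only [Matrix.mul_add, Matrix.add_mul, Matrix.mul_one, Matrix.mul_assoc]
    abel
  rw [e]
  exact (hS.yv.mul h.stable_Mr).sub (hS.yw.mul h.stable_Nr)

theorem IsStableEnvLoop.isRHInf_Ml_mul_Gwu (hS : IsStableEnvLoop G Hvv Hvw Hwv Hww)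
    (hH : IsEnvLoop G Gbar Hvv Hvw Hwv Hww)
    (h : IsDoublyCoprime (Gwv G) Nr Mr Ur Vr Nl Ml Ul Vl) : IsRHInf (Ml * Gwu G) := by
  have e : Ml * Gwu G = Ml * (Hww * Gwu G) - Nl * (Hvw * Gwu G) := by
    rw [hH.ww, ← h.Ml_mul]
    simp only [Matrix.mul_add, Matrix.add_mul, Matrix.one_mul, Matrix.mul_assoc]
    abel
  rw [e]
  exact (h.stable_Ml.mul hS.wu).sub (h.stable_Nl.mul hS.vu)

theorem plant_parameter (X : TransferMatrix v w) :
    plant G ((Ur + Mr * X) * Ml) =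
      tildeGyu G Ur Ml + Gyv G * Mr * X * (Ml * Gwu G) := by
  simp only [plant, tildeGyu, Matrix.mul_add, Matrix.add_mul, Matrix.mul_assoc, add_assoc]

/-- Every stable Youla parameter gives a proper environment. -/
theorem exists_isEnvLoop_of_parameter (hG : IsStrictRP (Gwv G))
    (h : IsDoublyCoprime (Gwv G) Nr Mr Ur Vr Nl Ml Ul Vl) {X : TransferMatrix v w}
    (hX : IsRHInf X) :
    ∃ Gbar : TransferMatrix v w, IsRP Gbar ∧
      IsEnvLoop G Gbar (1 + (Ur + Mr * X) * Nl) ((Ur + Mr * X) * Ml)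
        ((Vr + Nr * X) * Nl) ((Vr + Nr * X) * Ml) := by
  have hUstable : IsRHInf (Ur + Mr * X) := h.stable_Ur.add (h.stable_Mr.mul hX)
  have hMV : Ml * (Vr + Nr * X) = 1 + Nl * (Ur + Mr * X) := by
    rw [← h.Ml_mul, Matrix.mul_add, Matrix.mul_add, h.left_bezout, ← h.mul_Mr, ← h.Ml_mul]
    simp only [Matrix.mul_assoc, add_assoc]
  set U := Ur + Mr * X
  set V := Vr + Nr * X
  have hNl : IsStrictRP Nl := by
    rw [← h.Ml_mul]
    exact h.stable_Ml.isRP.mul_isStrictRP hG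
  -- `Ml V = 1 + Nl U` is the identity at infinity, so `V⁻¹ = W Ml` is proper, and the environment
  -- is `U V⁻¹`.
  obtain ⟨W, hW, hWV⟩ := (hNl.mul_isRP hUstable.isRP).neg.exists_one_sub_mul_eq_one
  rw [sub_neg_eq_add, ← hMV, Matrix.mul_assoc, mul_eq_one_comm, Matrix.mul_assoc,
    mul_eq_one_comm] at hWV
  have hinv : (V - Gwv G * U) * Ml = 1 := by
    rw [mul_eq_one_comm, Matrix.mul_sub, hMV, ← Matrix.mul_assoc, h.Ml_mul,
      add_sub_cancel_right]
  have hUV : U * (W * Ml) * V = U := by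
    rw [Matrix.mul_assoc, hWV, Matrix.mul_one]
  have hww : V * Ml = 1 + Gwv G * (U * Ml) := by
    rw [← hinv, Matrix.sub_mul, Matrix.mul_assoc]; abel
  refine ⟨U * (W * Ml), hUstable.isRP.mul (hW.mul h.stable_Ml.isRP), ?_, ?_, ?_, hww, ?_⟩
  · rw [← Matrix.mul_assoc _ V, hUV]
  · rw [← Matrix.mul_assoc _ V, hUV]
  · rw [← h.Ml_mul, ← Matrix.mul_assoc, hww]
    simp only [Matrix.mul_add, Matrix.add_mul, Matrix.mul_one, Matrix.one_mul, Matrix.mul_assoc]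
  · rw [← h.Ml_mul, Matrix.mul_assoc]

theorem isStableEnvLoop_of_parameter (h : IsDoublyCoprime (Gwv G) Nr Mr Ur Vr Nl Ml Ul Vl)
    (hA : IsRHInf (Gyv G * Mr)) (hB : IsRHInf (Ml * Gwu G)) (hP : IsRHInf (tildeGyu G Ur Ml))
    {X : TransferMatrix v w} (hX : IsRHInf X) :
    IsStableEnvLoop G (1 + (Ur + Mr * X) * Nl) ((Ur + Mr * X) * Ml)
        ((Vr + Nr * X) * Nl) ((Vr + Nr * X) * Ml) := by
  have hU : IsRHInf (Ur + Mr * X) := h.stable_Ur.add (h.stable_Mr.mul hX)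
  have hV : IsRHInf (Vr + Nr * X) := h.stable_Vr.add (h.stable_Nr.mul hX)
  -- `G_yv` may be unstable, so `Mr` is pulled out on the left to form the stable product `G_yv Mr`.
  have hyv : Gyv G * (1 + (Ur + Mr * X) * Nl) = Gyv G * Mr * (Vl + X * Nl) := by
    rw [Matrix.add_mul, ← add_assoc, ← h.Mr_mul_Vl, Matrix.mul_assoc Mr, ← Matrix.mul_add,
      Matrix.mul_assoc]
  have hyw : Gyv G * ((Ur + Mr * X) * Ml) = Gyv G * Mr * (Ul + X * Ml) := by
    rw [Matrix.add_mul, h.Ur_mul_Ml, Matrix.mul_assoc Mr, ← Matrix.mul_add, Matrix.mul_assoc]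
  refine ⟨?_, ?_, ?_, ?_, ?_, isRHInf_one.add (hU.mul h.stable_Nl), hU.mul h.stable_Ml,
    hV.mul h.stable_Nl, hV.mul h.stable_Ml⟩
  · rw [plant_parameter]
    exact hP.add ((hA.mul hX).mul hB)
  · rw [hyv]
    exact hA.mul (h.stable_Vl.add (hX.mul h.stable_Nl))
  · rw [hyw]
    exact hA.mul (h.stable_Ul.add (hX.mul h.stable_Ml))
  · rw [Matrix.mul_assoc]
    exact hU.mul hB
  · rw [Matrix.mul_assoc]
    exact hV.mul hB

end Coprime

/-! ### Rank-one test parameters. -/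

theorem single_eq_replicateCol_mul_replicateRow {m n R : Type*} [DecidableEq m] [DecidableEq n]
    [CommRing R] (i : m) (j : n) (c : R) :
    Matrix.single i j c =
      replicateCol Unit (Pi.single i c) * replicateRow Unit (Pi.single j (1 : R)) := by
  ext a b
  by_cases ha : i = a <;> by_cases hb : j = b <;>
    simp [Matrix.mul_apply, ha, hb, eq_comm]

/-- If `1 - X T` has a determinant invertible over `RH∞` for every stable `X`, then `T = 0`. -/
theorem eq_zero_of_forall_isRHInf_det_unit {w v : Type*} [Fintype w] [Fintype v] [DecidableEq w]
    [DecidableEq v] {T : TransferMatrix w v} (hT : IsRHInf T)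
    (h : ∀ X : TransferMatrix v w, IsRHInf X → ∃ d ∈ stableSubring, (1 - X * T).det * d = 1) :
    T = 0 := by
  ext i j
  by_contra hij
  obtain ⟨c, hc⟩ := exists_one_sub_C_mul_not_unit (hT i j) hij
  have hX : IsRHInf (Matrix.single j i (RatFunc.C c) : TransferMatrix v w) := by
    intro a b
    rw [Matrix.single_apply]
    split_ifs
    exacts [C_mem_stableSubring c, stableSubring.zero_mem]
  obtain ⟨d, hd, hd1⟩ := h _ hX
  refine hc d hd (Eq.trans ?_ hd1)
  congr 1
  -- Since `X` has rank one, Sylvester's identity reduces the determinant to the scalar `1 - c * T i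
  -- j`.
  rw [single_eq_replicateCol_mul_replicateRow, Matrix.mul_assoc, Matrix.det_one_sub_mul_comm, Matrix.det_unique]
  simp [Matrix.mul_apply, Pi.single_apply, mul_comm (T i j)]

end Retrofit

/-! ### The retrofit criterion. -/

open Retrofit in
theorem theorem1 {w y v u : Type*} [Fintype w] [Fintype y] [Fintype v] [Fintype u]
    [DecidableEq w] [DecidableEq y] [DecidableEq v] [DecidableEq u]
    (G : Retrofit.TransferMatrix (w ⊕ y) (v ⊕ u)) (hG : Retrofit.IsStrictRP G)
    (hpre : ∃ Gbar : Retrofit.TransferMatrix v w, Retrofit.IsAdmissible G Gbar)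
    (Nr : Retrofit.TransferMatrix w v) (Mr : Retrofit.TransferMatrix v v)
    (Ur : Retrofit.TransferMatrix v w) (Vr : Retrofit.TransferMatrix w w)
    (Nl : Retrofit.TransferMatrix w v) (Ml : Retrofit.TransferMatrix w w)
    (Ul : Retrofit.TransferMatrix v w) (Vl : Retrofit.TransferMatrix v v)
    (hcop : Retrofit.IsDoublyCoprime (Retrofit.Gwv G) Nr Mr Ur Vr Nl Ml Ul Vl)
    (K : Retrofit.TransferMatrix u y) (hK : Retrofit.IsRP K) :
    Retrofit.IsRetrofit G K ↔
      Retrofit.IsRHInf (Retrofit.tildeQ G Ur Ml K) ∧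
        Retrofit.Gwu G * Retrofit.tildeQ G Ur Ml K * Retrofit.Gyv G = 0 := by
  have hGwv : IsStrictRP (Gwv G) := fun i j => hG _ _
  obtain ⟨hA, hB, hP⟩ : IsRHInf (Gyv G * Mr) ∧ IsRHInf (Ml * Gwu G) ∧
      IsRHInf (tildeGyu G Ur Ml) := by
    obtain ⟨Gbar, hGbar, hstab⟩ := hpre
    obtain ⟨Hvv, Hvw, Hwv, Hww, hH⟩ := exists_isEnvLoop hGwv hGbar
    have hS := (internallyStable_zero_iff hH).1 hstab
    have hA := hS.isRHInf_Gyv_mul_Mr hH hcop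
    have hB := hS.isRHInf_Ml_mul_Gwu hH hcop
    obtain ⟨X, hX, rfl⟩ := hH.exists_parameter hS hcop
    refine ⟨hA, hB, ?_⟩
    have := hS.plant.sub ((hA.mul hX).mul hB)
    rwa [plant_parameter, add_sub_cancel_right] at this
  have hPstrict : IsStrictRP (tildeGyu G Ur Ml) := by
    rw [tildeGyu, Matrix.mul_assoc (Gyv G)]
    exact hG.plant (hcop.stable_Ur.mul hcop.stable_Ml).isRP
  have hunit := isUnit_one_sub_mul hPstrict hK
  have hQ : tildeQ G Ur Ml K = K * (1 + tildeGyu G Ur Ml * tildeQ G Ur Ml K) :=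
    (eq_inv_mul_iff hunit).1 rfl
  constructor
  · intro hret
    have key : ∀ X : TransferMatrix v w, IsRHInf X → ∃ Q : TransferMatrix u y, IsRHInf Q ∧
        Q = tildeQ G Ur Ml K + tildeQ G Ur Ml K * (Gyv G * Mr * X * (Ml * Gwu G) * Q) := by
      intro X hX
      obtain ⟨Gbar, hGbar, hH⟩ := exists_isEnvLoop_of_parameter hGwv hcop hX
      have hS := isStableEnvLoop_of_parameter hcop hA hB hP hX
      have hst := hret Gbar ⟨hGbar, (internallyStable_zero_iff hH).2 hS⟩
      have hQX := (eq_inv_mul_iff (isUnit_one_sub_mul (hG.plant hS.vw.isRP) hK)).1 rfl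
      refine ⟨_, (internallyStable_iff_isRHInf_youla hH hS hQX).1 hst, ?_⟩
      refine inv_mul_add_perturbation hunit ?_
      rwa [← plant_parameter]
    have hQstable : IsRHInf (tildeQ G Ur Ml K) := by
      obtain ⟨Q, hQ, h⟩ := key 0 isRHInf_zero
      simp only [Matrix.mul_zero, Matrix.zero_mul, add_zero] at h
      rwa [← h]
    refine ⟨hQstable, ?_⟩
    have hT : Ml * Gwu G * tildeQ G Ur Ml K * (Gyv G * Mr) = 0 := by
      refine eq_zero_of_forall_isRHInf_det_unit ((hB.mul hQstable).mul hA) fun X hX => ?_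
      obtain ⟨Q, hQ, h⟩ := key X hX
      refine ⟨(1 + Gyv G * Mr * X * (Ml * Gwu G) * Q).det,
        det_mem (S := stableSubring) (isRHInf_one.add (((hA.mul hX).mul hB).mul hQ)), ?_⟩
      -- Sylvester's identity moves `G_yv M_r` from the right end to the left.
      have hdet : (1 - X * (Ml * Gwu G * tildeQ G Ur Ml K * (Gyv G * Mr))).det =
          (1 - Gyv G * Mr * X * (Ml * Gwu G) * tildeQ G Ur Ml K).det := by
        rw [← Matrix.mul_assoc X, Matrix.det_one_sub_mul_comm]
        simp only [Matrix.mul_assoc]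
      rw [hdet, ← Matrix.det_mul, ← Matrix.det_one (n := y) (R := RatFunc ℝ)]
      congr 1
      -- Multiplying `Q = Q̃ + Q̃ D Q` by `D` gives `(1 - D Q̃)(1 + D Q) = 1`.
      set D := Gyv G * Mr * X * (Ml * Gwu G)
      have hD := congrArg (D * ·) h
      simp only [Matrix.mul_add] at hD
      refine eq_of_sub_eq_zero (Eq.trans ?_ (sub_eq_zero.2 hD))
      simp only [Matrix.mul_add, Matrix.sub_mul, Matrix.mul_one, Matrix.one_mul, Matrix.mul_assoc]
      abel
    have hl : Ml⁻¹ * Ml = 1 :=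
      Matrix.nonsing_inv_mul _ ((Matrix.isUnit_iff_isUnit_det _).1 hcop.isUnit_Ml)
    have hr : Mr * Mr⁻¹ = 1 :=
      Matrix.mul_nonsing_inv _ ((Matrix.isUnit_iff_isUnit_det _).1 hcop.isUnit_Mr)
    calc Gwu G * tildeQ G Ur Ml K * Gyv G
        = Ml⁻¹ * Ml * (Gwu G * tildeQ G Ur Ml K * Gyv G) * (Mr * Mr⁻¹) := by
          rw [hl, hr, Matrix.one_mul, Matrix.mul_one]
      _ = Ml⁻¹ * (Ml * Gwu G * tildeQ G Ur Ml K * (Gyv G * Mr)) * Mr⁻¹ := by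
          simp only [Matrix.mul_assoc]
      _ = 0 := by rw [hT, Matrix.mul_zero, Matrix.zero_mul]
  · rintro ⟨hQstable, hzero⟩ Gbar ⟨hGbar, hstab⟩
    obtain ⟨Hvv, Hvw, Hwv, Hww, hH⟩ := exists_isEnvLoop hGwv hGbar
    have hS := (internallyStable_zero_iff hH).1 hstab
    obtain ⟨X, hX, hHvw⟩ := hH.exists_parameter hS hcop
    have hplant : plant G Hvw = tildeGyu G Ur Ml + Gyv G * Mr * X * (Ml * Gwu G) := by
      rw [hHvw, plant_parameter]
    have hDQD : Gyv G * Mr * X * (Ml * Gwu G) * tildeQ G Ur Ml K *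
        (Gyv G * Mr * X * (Ml * Gwu G)) = 0 := by
      calc _ = Gyv G * Mr * X * Ml * (Gwu G * tildeQ G Ur Ml K * Gyv G) *
            (Mr * X * (Ml * Gwu G)) := by simp only [Matrix.mul_assoc]
        _ = 0 := by rw [hzero, Matrix.mul_zero, Matrix.zero_mul]
    set D := Gyv G * Mr * X * (Ml * Gwu G) with hD
    set Qt := tildeQ G Ur Ml K
    have hDstable : IsRHInf D := (hA.mul hX).mul hB
    -- The Neumann series for `Q` stops after two terms because `D Q̃ D = 0`.
    refine (internallyStable_iff_isRHInf_youla (Q := Qt + Qt * (D * Qt)) hH hS ?_).2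
      (hQstable.add (hQstable.mul (hDstable.mul hQstable)))
    have e : K * (tildeGyu G Ur Ml * Qt) = Qt - K := by
      rw [eq_sub_iff_add_eq, add_comm]
      nth_rw 2 [hQ]
      rw [Matrix.mul_add, Matrix.mul_one]
    have e' : (D * (Qt * (D * Qt))) = 0 := by
      rw [← Matrix.mul_assoc Qt, ← Matrix.mul_assoc, ← Matrix.mul_assoc, hDQD, Matrix.zero_mul]
    have e'' : K * (tildeGyu G Ur Ml * (Qt * (D * Qt))) = (Qt - K) * (D * Qt) := by
      rw [← e]
      simp only [Matrix.mul_assoc]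
    rw [hplant]
    simp only [Matrix.mul_add, Matrix.add_mul, Matrix.mul_one, e, e', e'', Matrix.mul_zero,
      Matrix.sub_mul]
    abel
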